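/- Let $\mathcal X,\mathcal Z$ be complex Hilbert spaces, $E\in\mathcal L(\mathcal X,\mathcal Z)$, and let $A:D(A)\subset\mathcal X\to\mathcal Z$ be a densely defined closed linear operator. Let $\varrho(E,A)$ be the set of $s\in\mathbb C$ such that $sE-A:D(A)\to\mathcal Z$ has an inverse $(sE-A)^{-1}\in\mathcal L(\mathcal Z,\mathcal X)$, and for such $s$ put $R^E(s,A)=(sE-A)^{-1}E$ and $L^E(s,A)=E(sE-A)^{-1}$. The operator $A$ is called *$E$-radial with constant $K>0$* if for all real $s>0$ one has $s\in\varrho(E,A)$ and $$\|R^E(s,A)^n\|\le \frac{K}{s^n},\qquad \|L^E(s,A)^n\|\le\frac{K}{s^n}\qquad (n=1,2,\dots).$$ Let $\alpha\in\mathbb R$, suppose that $A-\alpha E$ (with domain $D(A)$) is $E$-radial with constant $K$, and that $\operatorname{ran}E$ is closed. Then $(\alpha,\infty)\subset\varrho(E,A)$. For any $\mu\in\varrho(E,A)$ put $$\mathcal X^1=\overline{\operatorname{ran}R^E(\mu,A)},\qquad \mathcal Z^1=\overline{\operatorname{ran}L^E(\mu,A)},\qquad E_1=E|_{\mathcal X^1},\qquad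 A_1=A|_{D(A)\cap\mathcal X^1}.$$ Then $E_1$ is a boundedly invertible operator from $\mathcal X^1$ onto $\mathcal Z^1$, $A_1$ maps $D(A)\cap\mathcal X^1$ into $\mathcal Z^1$, and the following hold. 1. The operator $A_1E_1^{-1}$ with domain $E_1(D(A)\cap\mathcal X^1)$ is the generator of a $C_0$-semigroup $(S(t))_{t\ge0}$ on $\mathcal Z^1$ with $\|S(t)\|\le Ke^{\alpha t}$ for all $t\ge0$. 2. Well-posedness of $\frac{d}{dt}(Ex)=Ax$ reduces to that of $\dot z_1=A_1E_1^{-1}z_1$ in the following sense. A classical solution of $\frac{d}{dt}(Ex)=Ax$, $Ex(0)=z_0\in\mathcal Z$, is a function $x:[0,\infty)\to D(A)$ such that $Ax$ is continuous, $Ex$ is continuously differentiable, and the two equations hold; classical solutions of $\dot z_1=A_1E_1^{-1}z_1$ in $\mathcal Z^1$ are defined in the same way, with the identity of $\mathcal Z^1$ in place of $E$. For all $z_0\in\mathcal Z$, a function $x$ is a classical solution of $\frac{d}{dt}(Ex)=Ax$, $Ex(0)=z_0$, if and only if $z_0\in\mathcal Z^1$ and $x=E_1^{-1}z_1$ for a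 classical solution $z_1$ of $\dot z_1=A_1E_1^{-1}z_1$, $z_1(0)=z_0$. Call $\frac{d}{dt}(Ex)=Ax$ well-posed if for every $z_0\in E(D(A))$ there is exactly one classical solution with $Ex(0)=z_0$, and for every $T\ge 0$ there is a constant $C$ such that $\|x(t)\|\le C\|z_0\|$ for $0\le t\le T$ and every classical solution $x$ with initial value $z_0$; well-posedness of $\dot z_1=A_1E_1^{-1}z_1$ is defined in the same way, with the identity of $\mathcal Z^1$ in place of $E$. Then $\frac{d}{dt}(Ex)=Ax$ is well-posed if and only if $\dot z_1=A_1E_1^{-1}z_1$ is well-posed. -/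

import Mathlib

open Filter Topology
open scoped NNReal

noncomputable section

namespace OperatorPencil

section Resolvents

variable {X Z : Type*} [NormedAddCommGroup X] [NormedSpace ℂ X]
  [NormedAddCommGroup Z] [NormedSpace ℂ Z]

/-- `R : Z → X` is a bounded, everywhere defined, two-sided inverse of
`s E - A : D(A) → Z`. -/
def IsPencilInverse (E : X →L[ℂ] Z) (A : X →ₗ.[ℂ] Z) (s : ℂ) (R : Z →L[ℂ] X) : Prop :=
  (∀ z : Z, ∃ h : R z ∈ A.domain, s • E (R z) - A ⟨R z, h⟩ = z) ∧
    ∀ x : A.domain, R (s • E (x : X) - A x) = x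

/-- The resolvent set `ϱ(E, A) = {s | (s E - A)⁻¹ ∈ L(Z, X)}` of the operator pencil. -/
def resolventSet (E : X →L[ℂ] Z) (A : X →ₗ.[ℂ] Z) : Set ℂ :=
  {s | ∃ R : Z →L[ℂ] X, IsPencilInverse E A s R}

open Classical in
/-- The operator `(s E - A)⁻¹ ∈ L(Z, X)` for `s ∈ ϱ(E, A)` (and `0` for other `s`). -/
def pencilInv (E : X →L[ℂ] Z) (A : X →ₗ.[ℂ] Z) (s : ℂ) : Z →L[ℂ] X :=
  if h : s ∈ resolventSet E A then h.choose else 0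

theorem IsPencilInverse.unique {E : X →L[ℂ] Z} {A : X →ₗ.[ℂ] Z} {s : ℂ} {R R' : Z →L[ℂ] X}
    (h : IsPencilInverse E A s R) (h' : IsPencilInverse E A s R') : R = R' := by
  ext z
  obtain ⟨hz, hz'⟩ := h'.1 z
  have := h.2 ⟨R' z, hz⟩
  simpa [hz'] using this

theorem isPencilInverse_pencilInv {E : X →L[ℂ] Z} {A : X →ₗ.[ℂ] Z} {s : ℂ}
    (h : s ∈ resolventSet E A) : IsPencilInverse E A s (pencilInv E A s) := by
  rw [pencilInv, dif_pos h]
  exact h.choose_spec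

/-- The right `E`-resolvent `R^E(s, A) = (s E - A)⁻¹ E`. -/
def rightResolvent (E : X →L[ℂ] Z) (A : X →ₗ.[ℂ] Z) (s : ℂ) : X →L[ℂ] X :=
  (pencilInv E A s).comp E

/-- The left `E`-resolvent `L^E(s, A) = E (s E - A)⁻¹`. -/
def leftResolvent (E : X →L[ℂ] Z) (A : X →ₗ.[ℂ] Z) (s : ℂ) : Z →L[ℂ] Z :=
  E.comp (pencilInv E A s)

/-- `A` is `E`-radial, with constant `K`. -/
def IsRadialWith (E : X →L[ℂ] Z) (A : X →ₗ.[ℂ] Z) (K : ℝ) : Prop :=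
  0 < K ∧ ∀ s : ℝ, 0 < s → (s : ℂ) ∈ resolventSet E A ∧
    ∀ n : ℕ, 1 ≤ n →
      ‖rightResolvent E A (s : ℂ) ^ n‖ ≤ K / s ^ n ∧
      ‖leftResolvent E A (s : ℂ) ^ n‖ ≤ K / s ^ n

/-- The operator `A - α E` with domain `D(A)`. -/
def shift (E : X →L[ℂ] Z) (A : X →ₗ.[ℂ] Z) (α : ℝ) : X →ₗ.[ℂ] Z where
  domain := A.domain
  toFun := A.toFun - (α : ℂ) • ((E : X →ₗ[ℂ] Z).comp A.domain.subtype)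

/-- The space `X¹`, the closure of `ran R^E(μ, A)`. -/
def X1 (E : X →L[ℂ] Z) (A : X →ₗ.[ℂ] Z) (μ : ℂ) : Submodule ℂ X :=
  (LinearMap.range (rightResolvent E A μ : X →ₗ[ℂ] X)).topologicalClosure

/-- The space `Z¹`, the closure of `ran L^E(μ, A)`. -/
def Z1 (E : X →L[ℂ] Z) (A : X →ₗ.[ℂ] Z) (μ : ℂ) : Submodule ℂ Z :=
  (LinearMap.range (leftResolvent E A μ : Z →ₗ[ℂ] Z)).topologicalClosure

theorem map_mem_Z1 (E : X →L[ℂ] Z) (A : X →ₗ.[ℂ] Z) (μ : ℂ) (x : X1 E A μ) :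
    E (x : X) ∈ Z1 E A μ := by
  have hx : (x : X) ∈ closure (Set.range (rightResolvent E A μ)) := x.2
  refine map_mem_closure (f := E) E.continuous hx ?_
  rintro _ ⟨y, rfl⟩
  exact ⟨E y, rfl⟩

/-- The restriction `E₁ ∈ L(X¹, Z¹)` of `E` to `X¹`. -/
def E1 (E : X →L[ℂ] Z) (A : X →ₗ.[ℂ] Z) (μ : ℂ) : X1 E A μ →L[ℂ] Z1 E A μ :=
  (E.comp (X1 E A μ).subtypeL).codRestrict (Z1 E A μ) (map_mem_Z1 E A μ)

/-- The restriction `A₁` of `A` to `D(A₁) = D(A) ∩ X¹`, as an operator from `X¹` to `Z`. -/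
def A1 (E : X →L[ℂ] Z) (A : X →ₗ.[ℂ] Z) (μ : ℂ) : X1 E A μ →ₗ.[ℂ] Z where
  domain := A.domain.comap (X1 E A μ).subtype
  toFun := A.toFun.comp ((X1 E A μ).subtype.restrict fun _ hx => hx)

/-- The operator `A₁ E₁⁻¹` in `Z¹`, with its natural domain `{z | E₁⁻¹ z ∈ D(A₁)}`. Here `e` is `E₁`
as a boundedly invertible operator and `hA` says that `A₁` takes its values in `Z¹`. -/
def A1E1inv (E : X →L[ℂ] Z) (A : X →ₗ.[ℂ] Z) (μ : ℂ) (e : X1 E A μ ≃L[ℂ] Z1 E A μ)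
    (hA : ∀ x : (A1 E A μ).domain, A1 E A μ x ∈ Z1 E A μ) : Z1 E A μ →ₗ.[ℂ] Z1 E A μ where
  domain := (A1 E A μ).domain.comap (e.symm : Z1 E A μ →ₗ[ℂ] X1 E A μ)
  toFun := (((A1 E A μ).codRestrict (Z1 E A μ) hA).toFun).comp
    ((e.symm : Z1 E A μ →ₗ[ℂ] X1 E A μ).restrict fun _ hz => hz)

/-- `x` is a classical solution on `[0, ∞)` of `d/dt (E x) = A x`, `E x(0) = z₀`: one has
`x(t) ∈ D(A)` for all `t ≥ 0`, the function `y = A x` is continuous, and `E x` is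
differentiable with derivative `A x` (one-sided at `t = 0`), so that `E x` is `C¹`. -/
def IsClassicalSolution (E : X →L[ℂ] Z) (A : X →ₗ.[ℂ] Z) (z₀ : Z) (x : ℝ≥0 → X) : Prop :=
  E (x 0) = z₀ ∧ ∃ y : ℝ≥0 → Z, Continuous y ∧ (∀ t, (x t, y t) ∈ A.graph) ∧
    ∀ t : ℝ≥0, HasDerivWithinAt (fun s : ℝ => E (x s.toNNReal)) (y t) (Set.Ici 0) (t : ℝ)

/-- Well-posedness of `d/dt (E x) = A x`: for every `z₀ ∈ E(D(A))` there is exactly one classical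
solution with `E x(0) = z₀`, and solutions depend continuously on `z₀`, uniformly on compact time
intervals. For `E = I` this is well-posedness of the Cauchy problem `ẋ = A x`. -/
def IsWellPosed (E : X →L[ℂ] Z) (A : X →ₗ.[ℂ] Z) : Prop :=
  (∀ z₀ ∈ A.domain.map (E : X →ₗ[ℂ] Z), ∃! x : ℝ≥0 → X, IsClassicalSolution E A z₀ x) ∧
    ∀ T : ℝ≥0, ∃ C : ℝ, ∀ (z₀ : Z) (x : ℝ≥0 → X), IsClassicalSolution E A z₀ x →
      ∀ t ≤ T, ‖x t‖ ≤ C * ‖z₀‖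

end Resolvents

/-- A strongly continuous semigroup of bounded operators on `H`. -/
structure C0Semigroup (H : Type*) [NormedAddCommGroup H] [NormedSpace ℂ H] where
  /-- The operators of the semigroup. -/
  op : ℝ≥0 → H →L[ℂ] H
  op_zero : op 0 = ContinuousLinearMap.id ℂ H
  op_add : ∀ s t, op (s + t) = (op s).comp (op t)
  continuous_op : ∀ h : H, Continuous fun t => op t h

/-- `B` is the infinitesimal generator of `S`: `h ∈ D(B)` with `B h = k` if and only if
`t⁻¹ (S(t) h - h)` converges to `k` as `t ↓ 0`. -/
def C0Semigroup.IsGeneratedBy {H : Type*} [NormedAddCommGroup H] [NormedSpace ℂ H]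
    (S : C0Semigroup H) (B : H →ₗ.[ℂ] H) : Prop :=
  ∀ h k : H, (h, k) ∈ B.graph ↔
    Tendsto (fun t : ℝ≥0 => ((t : ℝ) : ℂ)⁻¹ • (S.op t h - h)) (𝓝[>] 0) (𝓝 k)

end OperatorPencil

end

noncomputable section

namespace OperatorPencil

/-! The right and left `E`-resolvents of `A - αE` are pseudo-resolvents `Q` with `‖Q s‖ ≤ K / s`.
For such a family `s Q(s)` tends strongly to the identity on the closure of `ran Q(1)` and vanishes
on `ker Q(1)`, so these two subspaces form a closed direct sum. In a Hilbert space the adjoints form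
a pseudo-resolvent with the same bound, which makes the sum the whole space (`exists_mem_closure`).

On `X` this gives `X = X¹ ⊕ ker E`, because `(sE - A)⁻¹` is injective. Hence `E` is injective on
`X¹` with `E(X¹) = ran E`. As `ran E` is closed, it equals `Z¹`, and the open mapping theorem makes
`E₁` an isomorphism. On `Z` the splitting allows every `x ∈ D(A)` to be corrected by an element of
`ker E` so that `A x` lands in `Z¹` (`exists_mem_graph`); this shows that `A₁` maps into `Z¹`.

The left resolvents restricted to `Z¹` are the resolvents of `A₁E₁⁻¹ - α`. They have dense range and
inherit the power bounds, so the Hille-Yosida theorem, proved here by Yosida approximation, gives a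
semigroup bounded by `K`; multiplication by `e^{αt}` undoes the shift. Finally, if `x` solves the
pencil equation, then `A x` is a derivative of a function with values in the closed space `ran E =
Z¹`. This forces `x` into `X¹`, so `E₁` transports solutions both ways. -/

/-- Strong convergence of a bounded family of operators passes to the closure of a set of
vectors. -/
theorem tendsto_apply_of_mem_closure {H ι : Type*} [NormedAddCommGroup H] [NormedSpace ℂ H]
    {l : Filter ι} {T : ι → H →L[ℂ] H} {T' : H →L[ℂ] H} {C : ℝ} {s : Set H}
    (hC : ∀ᶠ i in l, ∀ x, ‖T i x‖ ≤ C * ‖x‖)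
    (hs : ∀ y ∈ s, Tendsto (fun i => T i y) l (𝓝 (T' y))) {x : H} (hx : x ∈ closure s) :
    Tendsto (fun i => T i x) l (𝓝 (T' x)) := by
  rw [Metric.tendsto_nhds]
  intro ε hε
  set M : ℝ := |C| + ‖T'‖ + 1 with hM
  have hM0 : 0 < M := by positivity
  obtain ⟨y, hy, hxy⟩ := Metric.mem_closure_iff.1 hx (ε / (2 * M)) (by positivity)
  filter_upwards [hC, Metric.tendsto_nhds.1 (hs y hy) (ε / 2) (by positivity)] with i hi hiy
  rw [dist_eq_norm] at *
  have h1 : T i x - T' x = T i (x - y) + (T i y - T' y) + - T' (x - y) := by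
    simp only [map_sub]; abel
  have h2 : ‖T i (x - y)‖ ≤ |C| * ‖x - y‖ :=
    (hi _).trans (mul_le_mul_of_nonneg_right (le_abs_self C) (norm_nonneg _))
  have h3 := T'.le_opNorm (x - y)
  have h4 : M * ‖x - y‖ < ε / 2 := by
    calc M * ‖x - y‖ < M * (ε / (2 * M)) := by gcongr
      _ = ε / 2 := by field_simp
  have h5 : ‖T i x - T' x‖ ≤ ‖T i (x - y)‖ + ‖T i y - T' y‖ + ‖T' (x - y)‖ := by
    rw [h1]
    exact (norm_add₃_le).trans (by rw [norm_neg])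
  have h6 := norm_nonneg (x - y)
  nlinarith

/-! ### Pseudo-resolvents and the splitting into range closure and kernel -/

/-- A pseudo-resolvent on `(0, ∞)` with `‖Q s‖ ≤ K / s`. -/
structure IsPseudoResolvent {H : Type*} [NormedAddCommGroup H] [NormedSpace ℂ H]
    (Q : ℝ → H →L[ℂ] H) (K : ℝ) : Prop where
  identity : ∀ s t, 0 < s → 0 < t → Q s - Q t = ((t - s : ℝ) : ℂ) • (Q s * Q t)
  bound : ∀ s, 0 < s → ‖Q s‖ ≤ K / s

namespace IsPseudoResolvent

section Normed

variable {H : Type*} [NormedAddCommGroup H] [NormedSpace ℂ H] {Q : ℝ → H →L[ℂ] H} {K : ℝ}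

theorem nonneg (hQ : IsPseudoResolvent Q K) : 0 ≤ K := by
  simpa using (norm_nonneg _).trans (hQ.bound 1 one_pos)

theorem norm_apply_le (hQ : IsPseudoResolvent Q K) {s : ℝ} (hs : 0 < s) (x : H) :
    ‖Q s x‖ ≤ K / s * ‖x‖ :=
  (Q s).le_of_opNorm_le (hQ.bound s hs) x

theorem norm_smul_apply_le (hQ : IsPseudoResolvent Q K) {s : ℝ} (hs : 0 < s) (x : H) :
    ‖((s : ℂ) • Q s) x‖ ≤ K * ‖x‖ := by
  rw [smul_apply, norm_smul, Complex.norm_real, Real.norm_of_nonneg hs.le]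
  calc s * ‖Q s x‖ ≤ s * (K / s * ‖x‖) := by gcongr; exact hQ.norm_apply_le hs x
    _ = K * ‖x‖ := by field_simp

theorem identity_apply (hQ : IsPseudoResolvent Q K) {s t : ℝ} (hs : 0 < s) (ht : 0 < t) (x : H) :
    Q s x - Q t x = ((t - s : ℝ) : ℂ) • Q s (Q t x) := by
  simpa using congrArg (fun T : H →L[ℂ] H => T x) (hQ.identity s t hs ht)

theorem commute (hQ : IsPseudoResolvent Q K) {s t : ℝ} (hs : 0 < s) (ht : 0 < t) :
    Commute (Q s) (Q t) := by
  rcases eq_or_ne s t with rfl | hst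
  · exact Commute.refl _
  have h1 := hQ.identity s t hs ht
  have h2 := hQ.identity t s ht hs
  have h3 : ((t - s : ℝ) : ℂ) • (Q s * Q t) = ((t - s : ℝ) : ℂ) • (Q t * Q s) := by
    rw [← h1, ← neg_sub (Q t), h2, ← neg_smul]
    congr 1
    push_cast
    ring
  have h4 : ((t - s : ℝ) : ℂ) ≠ 0 := by
    exact_mod_cast sub_ne_zero.2 hst.symm
  exact smul_right_injective _ h4 h3

/-- On the range, the resolvent identity gives `s Q(s) Q(1)y - Q(1)y = Q(s)(Q(1)y - y) = O(1/s)`.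
The uniform bound `K` on `s Q(s)` extends the limit to the closure. -/
theorem tendsto_smul_apply (hQ : IsPseudoResolvent Q K) {x : H}
    (hx : x ∈ closure (Set.range (Q 1))) :
    Tendsto (fun s : ℝ => ((s : ℂ) • Q s) x) atTop (𝓝 x) := by
  refine tendsto_apply_of_mem_closure (T' := ContinuousLinearMap.id ℂ H) (C := K) ?_ ?_ hx
  · filter_upwards [eventually_gt_atTop 0] with s hs x using hQ.norm_smul_apply_le hs x
  rintro _ ⟨y, rfl⟩
  rw [tendsto_iff_norm_sub_tendsto_zero]
  have hlim : Tendsto (fun s : ℝ => K / s * ‖Q 1 y - y‖) atTop (𝓝 0) := by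
    simpa using (tendsto_const_nhds.div_atTop tendsto_id).mul_const ‖Q 1 y - y‖
  refine squeeze_zero' (Eventually.of_forall fun _ => norm_nonneg _) ?_ hlim
  filter_upwards [eventually_gt_atTop 0] with s hs
  have h1 := hQ.identity_apply hs one_pos y
  have h2 : ((s : ℂ) • Q s) (Q 1 y) - ContinuousLinearMap.id ℂ H (Q 1 y)
      = Q s (Q 1 y - y) := by
    have h3 : Q 1 y = Q s y - ((1 - s : ℝ) : ℂ) • Q s (Q 1 y) := by rw [← h1]; abel
    simp only [smul_apply, ContinuousLinearMap.id_apply, map_sub]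
    push_cast at h3
    linear_combination (norm := module) -h3
  rw [h2]
  exact hQ.norm_apply_le hs _

theorem apply_eq_zero (hQ : IsPseudoResolvent Q K) {x : H} (hx : Q 1 x = 0) {s : ℝ}
    (hs : 0 < s) : Q s x = 0 := by
  simpa [hx] using hQ.identity_apply hs one_pos x

/-- Since `Q(s)` kills `n`, `s Q(s)(v + n) = s Q(s)v → v`. Thus the projection onto the range
closure along the kernel has norm at most `K`. -/
theorem norm_le_norm_add (hQ : IsPseudoResolvent Q K) {v n : H}
    (hv : v ∈ closure (Set.range (Q 1))) (hn : Q 1 n = 0) : ‖v‖ ≤ K * ‖v + n‖ := by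
  refine le_of_tendsto (hQ.tendsto_smul_apply hv).norm ?_
  filter_upwards [eventually_gt_atTop 0] with s hs
  simpa [hQ.apply_eq_zero hn hs] using hQ.norm_smul_apply_le hs (v + n)

theorem eq_zero_of_mem_closure (hQ : IsPseudoResolvent Q K) {v : H}
    (hv : v ∈ closure (Set.range (Q 1))) (hn : Q 1 v = 0) : v = 0 := by
  have := hQ.norm_le_norm_add hv (n := -v) (by simp [hn])
  simpa using this

end Normed

section Hilbert

variable {H : Type*} [NormedAddCommGroup H] [InnerProductSpace ℂ H] [CompleteSpace H]
  {Q : ℝ → H →L[ℂ] H} {K : ℝ}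

theorem adjoint (hQ : IsPseudoResolvent Q K) :
    IsPseudoResolvent (fun s => ContinuousLinearMap.adjoint (Q s)) K where
  identity s t hs ht := by
    have h := congrArg star (hQ.identity t s ht hs)
    simp only [star_sub, star_smul, star_mul, ContinuousLinearMap.star_eq_adjoint,
      RCLike.star_def, Complex.conj_ofReal] at h
    rw [← neg_sub, h, ← neg_smul]
    congr 1
    push_cast
    ring
  bound s hs := by
    rw [LinearIsometryEquiv.norm_map]
    exact hQ.bound s hs

/-- The projection bound makes addition `V × N → H` bounded below, and a bounded-below map on a
complete space has closed range. -/
theorem isClosed_sup (hQ : IsPseudoResolvent Q K) :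
    IsClosed (((Q 1).range.topologicalClosure ⊔ (Q 1).ker : Submodule ℂ H) : Set H) := by
  set V := (Q 1).range.topologicalClosure
  set N := (Q 1).ker
  have : CompleteSpace V := (Submodule.isClosed_topologicalClosure _).completeSpace_coe
  have : CompleteSpace N := (Q 1).isClosed_ker.completeSpace_coe
  set f : V × N →L[ℂ] H := V.subtypeL.coprod N.subtypeL
  have hf : AntilipschitzWith (K + 1).toNNReal f := by
    refine ContinuousLinearMap.antilipschitz_of_bound _ fun p => ?_
    have hp : f p = (p.1 : H) + p.2 := rfl
    have h1 : ‖(p.1 : H)‖ ≤ K * ‖(p.1 : H) + p.2‖ := hQ.norm_le_norm_add p.1.2 p.2.2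
    have h2 : ‖(p.2 : H)‖ ≤ ‖(p.1 : H) + p.2‖ + ‖(p.1 : H)‖ := by
      simpa using norm_sub_le ((p.1 : H) + p.2) p.1
    rw [Real.coe_toNNReal _ (by linarith [hQ.nonneg]), hp, Prod.norm_def]
    refine max_le ?_ ?_
    · have := norm_nonneg ((p.1 : H) + p.2)
      change ‖(p.1 : H)‖ ≤ _
      linarith
    · change ‖(p.2 : H)‖ ≤ _
      linarith
  have := hf.isClosed_range f.uniformContinuous
  have hr : ((V ⊔ N : Submodule ℂ H) : Set H) = Set.range f := by
    ext x
    simp only [SetLike.mem_coe, Submodule.mem_sup, Set.mem_range, Prod.exists]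
    constructor
    · rintro ⟨v, hv, n, hn, rfl⟩
      exact ⟨⟨v, hv⟩, ⟨n, hn⟩, rfl⟩
    · rintro ⟨v, n, rfl⟩
      exact ⟨v, v.2, n, n.2, rfl⟩
  rwa [hr]

/-- The orthogonal complement of the sum is the intersection of `ker Q(1)*` with the closure of `ran
Q(1)*`. It is zero because the adjoints are again a pseudo-resolvent. -/
theorem exists_mem_closure (hQ : IsPseudoResolvent Q K) (x : H) :
    ∃ y ∈ closure (Set.range (Q 1)), Q 1 (x - y) = 0 := by
  have htop : (Q 1).range.topologicalClosure ⊔ (Q 1).ker = ⊤ := by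
    rw [← hQ.isClosed_sup.submodule_topologicalClosure_eq, Submodule.topologicalClosure_eq_top_iff,
      ← Submodule.inf_orthogonal, Submodule.orthogonal_closure, eq_bot_iff]
    rintro y ⟨h1, h2⟩
    rw [SetLike.mem_coe, ContinuousLinearMap.orthogonal_range] at h1
    rw [SetLike.mem_coe, ContinuousLinearMap.orthogonal_ker] at h2
    exact hQ.adjoint.eq_zero_of_mem_closure h2 h1
  obtain ⟨y, hy, n, hn, rfl⟩ := Submodule.mem_sup.1 (htop ▸ Submodule.mem_top (x := x))
  exact ⟨y, hy, by simpa using hn⟩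

end Hilbert

end IsPseudoResolvent

/-! ### Estimates for exponentials of bounded operators -/

section ExpBounds

variable {H : Type*} [NormedAddCommGroup H] [NormedSpace ℂ H]

theorem norm_exp_le_of_norm_pow_le {𝔸 : Type*} [NormedRing 𝔸] [NormedAlgebra ℝ 𝔸]
    [CompleteSpace 𝔸] {a : 𝔸} {K r : ℝ} (h : ∀ n : ℕ, ‖a ^ n‖ ≤ K * r ^ n) :
    ‖NormedSpace.exp a‖ ≤ K * Real.exp r := by
  have h1 := NormedSpace.exp_series_hasSum_exp' (𝕂 := ℝ) a
  have h2 := (NormedSpace.exp_series_hasSum_exp' (𝕂 := ℝ) r).mul_left K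
  rw [← Real.exp_eq_exp_ℝ] at h2
  rw [← h1.tsum_eq]
  refine tsum_of_norm_bounded h2 fun n => ?_
  rw [norm_smul, Real.norm_of_nonneg (by positivity), smul_eq_mul]
  calc ((n.factorial : ℝ)⁻¹) * ‖a ^ n‖ ≤ ((n.factorial : ℝ)⁻¹) * (K * r ^ n) := by
        gcongr; exact h n
    _ = _ := by ring

theorem commute_exp_right {a b : H →L[ℂ] H} (h : Commute a b) :
    Commute a (NormedSpace.exp b) := by
  let : NormedAlgebra ℚ (H →L[ℂ] H) := NormedAlgebra.restrictScalars ℚ ℂ _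
  exact h.exp_right

variable [CompleteSpace H]

theorem exp_add_of_commute {a b : H →L[ℂ] H} (h : Commute a b) :
    NormedSpace.exp (a + b) = NormedSpace.exp a * NormedSpace.exp b := by
  let : NormedAlgebra ℚ (H →L[ℂ] H) := NormedAlgebra.restrictScalars ℚ ℂ _
  exact NormedSpace.exp_add_of_commute h

theorem hasDerivAt_exp_smul_apply (Y : H →L[ℂ] H) (h : H) (t : ℝ) :
    HasDerivAt (fun u : ℝ => NormedSpace.exp (u • Y) h) (NormedSpace.exp (t • Y) (Y h)) t := by
  have h1 := hasDerivAt_exp_smul_const Y t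
  exact ((ContinuousLinearMap.apply ℂ H h).restrictScalars ℝ).hasFDerivAt.comp_hasDerivAt t h1

variable {Y W : H →L[ℂ] H} {K : ℝ}

/-- The curve `u ↦ e^{uY} e^{(t-u)W} h` joins the two vectors. By commutativity its derivative is
`e^{uY} e^{(t-u)W}(Y - W)h`, and the mean value inequality applies. -/
theorem norm_exp_smul_sub_le (hYW : Commute Y W)
    (hY : ∀ t : ℝ, 0 ≤ t → ‖NormedSpace.exp (t • Y)‖ ≤ K)
    (hW : ∀ t : ℝ, 0 ≤ t → ‖NormedSpace.exp (t • W)‖ ≤ K) {t : ℝ} (ht : 0 ≤ t) (h : H) :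
    ‖NormedSpace.exp (t • Y) h - NormedSpace.exp (t • W) h‖ ≤ K * K * ‖Y h - W h‖ * t := by
  have hK : 0 ≤ K := (norm_nonneg _).trans (hY 0 le_rfl)
  have hder : ∀ s : ℝ, HasDerivAt
      (fun u : ℝ => (NormedSpace.exp (u • Y) * NormedSpace.exp ((t - u) • W)) h)
      ((NormedSpace.exp (s • Y) * NormedSpace.exp ((t - s) • W)) (Y h - W h)) s := by
    intro s
    have h1 := hasDerivAt_exp_smul_const Y s
    have h2 := (hasDerivAt_exp_smul_const W (t - s)).scomp s
      ((hasDerivAt_id s).const_sub t)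
    have h3 := h1.mul h2
    have h4 := ((ContinuousLinearMap.apply ℂ H h).restrictScalars ℝ).hasFDerivAt.comp_hasDerivAt
      s h3
    refine HasDerivAt.congr_deriv h4 ?_
    have hc : Y * NormedSpace.exp ((t - s) • W) = NormedSpace.exp ((t - s) • W) * Y :=
      commute_exp_right (hYW.smul_right _)
    have : NormedSpace.exp (s • Y) * Y * NormedSpace.exp ((t - s) • W)
        = NormedSpace.exp (s • Y) * NormedSpace.exp ((t - s) • W) * Y := by
      rw [mul_assoc, hc, mul_assoc]
    change (NormedSpace.exp (s • Y) * Y * NormedSpace.exp ((t - s) • W)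
      + NormedSpace.exp (s • Y) * (-1 : ℝ) • (NormedSpace.exp ((t - s) • W) * W)) h = _
    rw [this]
    simp [← sub_eq_add_neg]
  have h1 := norm_image_sub_le_of_norm_deriv_le_segment' (a := 0) (b := t)
    (C := K * K * ‖Y h - W h‖) (fun s _ => (hder s).hasDerivWithinAt) ?_ t ⟨ht, le_rfl⟩
  · simpa using h1
  intro s hs
  refine ContinuousLinearMap.le_of_opNorm_le _ ?_ _
  exact (norm_mul_le _ _).trans
    (mul_le_mul (hY s hs.1) (hW _ (sub_nonneg.2 hs.2.le)) (norm_nonneg _) hK)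

theorem norm_exp_smul_apply_sub_le (hY : ∀ t : ℝ, 0 ≤ t → ‖NormedSpace.exp (t • Y)‖ ≤ K)
    {t : ℝ} (ht : 0 ≤ t) (h : H) :
    ‖NormedSpace.exp (t • Y) h - h‖ ≤ K * K * ‖Y h‖ * t := by
  have h0 : ∀ t : ℝ, 0 ≤ t → ‖NormedSpace.exp (t • (0 : H →L[ℂ] H))‖ ≤ K := by
    intro t _
    simpa using hY 0 le_rfl
  simpa using norm_exp_smul_sub_le (Commute.zero_right Y) hY h0 ht h

theorem norm_exp_smul_apply_sub_apply_le
    (hY : ∀ t : ℝ, 0 ≤ t → ‖NormedSpace.exp (t • Y)‖ ≤ K) {s t : ℝ} (hs : 0 ≤ s) (hst : s ≤ t)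
    (h : H) :
    ‖NormedSpace.exp (t • Y) h - NormedSpace.exp (s • Y) h‖ ≤ K * (K * K * ‖Y h‖ * (t - s)) := by
  have h1 : t • Y = s • Y + (t - s) • Y := by module
  have h2 : NormedSpace.exp (t • Y) h - NormedSpace.exp (s • Y) h
      = NormedSpace.exp (s • Y) (NormedSpace.exp ((t - s) • Y) h - h) := by
    rw [h1, exp_add_of_commute (((Commute.refl Y).smul_left s).smul_right _)]
    simp
  rw [h2]
  exact ContinuousLinearMap.le_of_opNorm_le_of_le _ (hY s hs)
    (norm_exp_smul_apply_sub_le hY (sub_nonneg.2 hst) h)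

/-- Gives the derivative at `0` uniformly along the Yosida approximations: `k` will be the limit of
`Y h`, and `k'` an approximation of `k` on which `Y` stays bounded. -/
theorem norm_exp_smul_apply_sub_sub_le (hY : ∀ t : ℝ, 0 ≤ t → ‖NormedSpace.exp (t • Y)‖ ≤ K)
    {t : ℝ} (ht : 0 ≤ t) (h k k' : H) :
    ‖NormedSpace.exp (t • Y) h - h - t • k‖
      ≤ (K * ‖Y h - k‖ + (K + 1) * ‖k - k'‖ + K * K * ‖Y k'‖ * t) * t := by
  have hK : 0 ≤ K := (norm_nonneg _).trans (hY 0 le_rfl)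
  have hder : ∀ s : ℝ, HasDerivAt (fun u : ℝ => NormedSpace.exp (u • Y) h - u • k)
      (NormedSpace.exp (s • Y) (Y h) - k) s := by
    intro s
    simpa using! (hasDerivAt_exp_smul_apply Y h s).sub ((hasDerivAt_id s).smul_const k)
  have h1 := norm_image_sub_le_of_norm_deriv_le_segment' (a := 0) (b := t)
    (C := K * ‖Y h - k‖ + (K + 1) * ‖k - k'‖ + K * K * ‖Y k'‖ * t)
    (fun s _ => (hder s).hasDerivWithinAt) ?_ t ⟨ht, le_rfl⟩
  · have h2 : NormedSpace.exp (t • Y) h - h - t • k = NormedSpace.exp (t • Y) h - t • k - h := by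
      abel
    rw [h2]
    simpa using h1
  intro s hs
  have h3 : NormedSpace.exp (s • Y) (Y h) - k
      = NormedSpace.exp (s • Y) (Y h - k) + NormedSpace.exp (s • Y) (k - k')
        + (NormedSpace.exp (s • Y) k' - k') + (k' - k) := by
    simp only [map_sub]; abel
  have h4 := ContinuousLinearMap.le_of_opNorm_le _ (hY s hs.1) (Y h - k)
  have h5 := ContinuousLinearMap.le_of_opNorm_le _ (hY s hs.1) (k - k')
  have h6 := norm_exp_smul_apply_sub_le hY hs.1 k'
  have h7 : K * K * ‖Y k'‖ * s ≤ K * K * ‖Y k'‖ * t := by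
    gcongr
    exact hs.2.le
  rw [h3]
  refine (norm_add_le _ _).trans ?_
  rw [norm_sub_rev k' k]
  linarith [norm_add₃_le (a := NormedSpace.exp (s • Y) (Y h - k))
    (b := NormedSpace.exp (s • Y) (k - k')) (c := NormedSpace.exp (s • Y) k' - k')]

/-- If `‖Tⁿ‖ ≤ K / sⁿ`, then the Yosida approximation `s² T - s` generates a group bounded by `K`
on `[0, ∞)`. -/
theorem norm_exp_yosida_le {T : H →L[ℂ] H} {s : ℝ} (hs : 0 < s)
    (hT : ∀ n : ℕ, ‖T ^ n‖ ≤ K / s ^ n) {t : ℝ} (ht : 0 ≤ t) :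
    ‖NormedSpace.exp (t • (s ^ 2 • T - s • (1 : H →L[ℂ] H)))‖ ≤ K := by
  have h1 : t • (s ^ 2 • T - s • (1 : H →L[ℂ] H))
      = (t * s ^ 2) • T + algebraMap ℝ (H →L[ℂ] H) (-(t * s)) := by
    rw [Algebra.algebraMap_eq_smul_one]
    module
  -- The scalar part contributes `e^{-ts}`, which cancels the growth `e^{ts}` of the series for
  -- `e^{ts²T}`.
  rw [h1, exp_add_of_commute (Algebra.commute_algebraMap_right _ _),
    ← NormedSpace.algebraMap_exp_comm (-(t * s)), ← Real.exp_eq_exp_ℝ,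
    ← Algebra.commutes, ← Algebra.smul_def, norm_smul, Real.norm_of_nonneg (Real.exp_pos _).le]
  have h2 : ‖NormedSpace.exp ((t * s ^ 2) • T)‖ ≤ K * Real.exp (t * s) := by
    refine norm_exp_le_of_norm_pow_le fun n => ?_
    rw [smul_pow, norm_smul, Real.norm_of_nonneg (by positivity)]
    calc (t * s ^ 2) ^ n * ‖T ^ n‖ ≤ (t * s ^ 2) ^ n * (K / s ^ n) := by gcongr; exact hT n
      _ = K * (t * s) ^ n := by
        have : (t * s ^ 2) ^ n = (t * s) ^ n * s ^ n := by ring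
        rw [this]
        field_simp
  calc Real.exp (-(t * s)) * ‖NormedSpace.exp ((t * s ^ 2) • T)‖
      ≤ Real.exp (-(t * s)) * (K * Real.exp (t * s)) := by gcongr
    _ = K := by rw [Real.exp_neg]; field_simp

end ExpBounds

/-! ### Hille-Yosida theorem -/

theorem cauchySeq_apply_of_mem_closure {H : Type*} [NormedAddCommGroup H] [NormedSpace ℂ H]
    {T : ℕ → H →L[ℂ] H} {C : ℝ} {s : Set H} (hC : ∀ i, ‖T i‖ ≤ C)
    (hs : ∀ y ∈ s, CauchySeq fun i => T i y) {x : H} (hx : x ∈ closure s) :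
    CauchySeq fun i => T i x := by
  have hC0 : 0 ≤ C := (norm_nonneg _).trans (hC 0)
  rw [Metric.cauchySeq_iff']
  intro ε hε
  obtain ⟨y, hy, hxy⟩ := Metric.mem_closure_iff.1 hx (ε / (4 * (C + 1))) (by positivity)
  obtain ⟨N, hN⟩ := Metric.cauchySeq_iff'.1 (hs y hy) (ε / 2) (by positivity)
  refine ⟨N, fun n hn => ?_⟩
  have h1 := hN n hn
  rw [dist_eq_norm] at *
  have h2 : T n x - T N x = T n (x - y) + (T n y - T N y) + - T N (x - y) := by
    simp only [map_sub]; abel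
  have h3 := (T n).le_of_opNorm_le (hC n) (x - y)
  have h4 := (T N).le_of_opNorm_le (hC N) (x - y)
  have h5 : (C + 1) * ‖x - y‖ < ε / 4 := by
    calc (C + 1) * ‖x - y‖ < (C + 1) * (ε / (4 * (C + 1))) := by gcongr
      _ = ε / 4 := by field_simp
  have h6 : ‖T n x - T N x‖ ≤ ‖T n (x - y)‖ + ‖T n y - T N y‖ + ‖T N (x - y)‖ := by
    rw [h2]
    exact norm_add₃_le.trans (by rw [norm_neg])
  linarith [norm_nonneg (x - y)]

namespace IsPseudoResolvent

variable {H : Type*} [NormedAddCommGroup H] [NormedSpace ℂ H] {Q : ℝ → H →L[ℂ] H} {K : ℝ}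

/-- The Yosida approximations `(n + 1)² Q(n + 1) - (n + 1)`. -/
def yosida (Q : ℝ → H →L[ℂ] H) (n : ℕ) : H →L[ℂ] H :=
  ((n : ℝ) + 1) ^ 2 • Q (n + 1) - ((n : ℝ) + 1) • (1 : H →L[ℂ] H)

theorem commute_yosida (hQ : IsPseudoResolvent Q K) {s : ℝ} (hs : 0 < s) (n : ℕ) :
    Commute (Q s) (yosida Q n) :=
  ((hQ.commute hs n.cast_add_one_pos).smul_right _).sub_right
    ((Commute.one_right _).smul_right _)

theorem yosida_commute_yosida (hQ : IsPseudoResolvent Q K) (m n : ℕ) :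
    Commute (yosida Q m) (yosida Q n) :=
  ((hQ.commute_yosida m.cast_add_one_pos n).smul_left _).sub_left
    ((Commute.one_left _).smul_left _)

theorem tendsto_smul_apply_of_denseRange (hQ : IsPseudoResolvent Q K) (hd : DenseRange (Q 1))
    (x : H) : Tendsto (fun s : ℝ => ((s : ℂ) • Q s) x) atTop (𝓝 x) :=
  hQ.tendsto_smul_apply (hd x)

/-- With `s = n + 1`, the resolvent identity turns the left side into `s Q(s)(Q(1)g - g)`. -/
theorem tendsto_yosida (hQ : IsPseudoResolvent Q K) (hd : DenseRange (Q 1)) (g : H) :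
    Tendsto (fun n => yosida Q n (Q 1 g)) atTop (𝓝 (Q 1 g - g)) := by
  have h1 : Tendsto (fun n : ℕ => (n : ℝ) + 1) atTop atTop :=
    tendsto_natCast_atTop_atTop.atTop_add tendsto_const_nhds
  refine ((hQ.tendsto_smul_apply_of_denseRange hd (Q 1 g - g)).comp h1).congr fun n => ?_
  set s : ℝ := (n : ℝ) + 1 with hs
  have hs0 : 0 < s := n.cast_add_one_pos
  have h2 : Q s g - Q 1 g = (1 - s) • Q s (Q 1 g) := by
    rw [hQ.identity_apply hs0 one_pos, Complex.coe_smul]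
  have h3 : Q s g = Q 1 g + (1 - s) • Q s (Q 1 g) := by rw [← h2]; abel
  simp only [Function.comp_apply, yosida, ← hs, smul_apply, sub_apply, one_apply_eq_self, map_sub,
    Complex.coe_smul]
  rw [h3]
  module

/-- Supplies the exponent `n = 0` in the power bounds, which are assumed only for `n ≥ 1`. -/
theorem one_norm_le (hQ : IsPseudoResolvent Q K) (hd : DenseRange (Q 1)) :
    ‖(1 : H →L[ℂ] H)‖ ≤ K := by
  refine ContinuousLinearMap.opNorm_le_bound _ hQ.nonneg fun x => ?_
  refine le_of_tendsto (hQ.tendsto_smul_apply_of_denseRange hd x).norm ?_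
  filter_upwards [eventually_gt_atTop 0] with s hs using hQ.norm_smul_apply_le hs x

variable [CompleteSpace H]

theorem norm_exp_smul_yosida_le (hQ : IsPseudoResolvent Q K) (hd : DenseRange (Q 1))
    (hpow : ∀ s : ℝ, 0 < s → ∀ n : ℕ, 1 ≤ n → ‖Q s ^ n‖ ≤ K / s ^ n) (m : ℕ) (t : ℝ)
    (ht : 0 ≤ t) : ‖NormedSpace.exp (t • yosida Q m)‖ ≤ K := by
  refine norm_exp_yosida_le m.cast_add_one_pos (fun n => ?_) ht
  rcases n.eq_zero_or_pos with rfl | hn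
  · simpa using hQ.one_norm_le hd
  · exact hpow _ m.cast_add_one_pos n hn

/-- The Yosida semigroups converge strongly. -/
theorem exists_tendsto_exp_smul_yosida (hQ : IsPseudoResolvent Q K) (hd : DenseRange (Q 1))
    (hpow : ∀ s : ℝ, 0 < s → ∀ n : ℕ, 1 ≤ n → ‖Q s ^ n‖ ≤ K / s ^ n) (t : ℝ≥0) :
    ∃ T : H →L[ℂ] H, ∀ h, Tendsto (fun n => NormedSpace.exp ((t : ℝ) • yosida Q n) h) atTop
      (𝓝 (T h)) := by
  have hE := hQ.norm_exp_smul_yosida_le hd hpow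
  have hc : ∀ h, CauchySeq fun n => NormedSpace.exp ((t : ℝ) • yosida Q n) h := by
    intro h
    refine cauchySeq_apply_of_mem_closure (fun n => hE n t t.2) ?_ (hd h)
    rintro _ ⟨g, rfl⟩
    have h1 := (hQ.tendsto_yosida hd g).cauchySeq
    have hK := hQ.nonneg
    rw [Metric.cauchySeq_iff'] at h1 ⊢
    intro ε hε
    obtain ⟨N, hN⟩ := h1 (ε / (K * K * t + 1)) (by positivity)
    refine ⟨N, fun n hn => ?_⟩
    have h2 := hN n hn
    rw [dist_eq_norm] at *
    have h3 := norm_exp_smul_sub_le (hQ.yosida_commute_yosida n N) (hE n) (hE N) t.2 (Q 1 g)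
    rw [lt_div_iff₀ (by positivity)] at h2
    have h4 := norm_nonneg (yosida Q n (Q 1 g) - yosida Q N (Q 1 g))
    calc _ ≤ _ := h3
      _ ≤ ‖yosida Q n (Q 1 g) - yosida Q N (Q 1 g)‖ * (K * K * t + 1) := by
        rw [NNReal.val_eq_coe]
        linarith
      _ < ε := h2
  choose f hf using fun h => cauchySeq_tendsto_of_complete (hc h)
  exact ⟨continuousLinearMapOfTendsto (fun n => NormedSpace.exp ((t : ℝ) • yosida Q n))
    (tendsto_pi_nhds.2 hf), hf⟩

/-- The Hille-Yosida theorem (Feller, Miyadera, Phillips), in terms of the resolvent: the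
generator has the graph `{(h, k) | Q 1 (h - k) = h}`. -/
theorem exists_c0Semigroup (hQ : IsPseudoResolvent Q K) (hd : DenseRange (Q 1))
    (hpow : ∀ s : ℝ, 0 < s → ∀ n : ℕ, 1 ≤ n → ‖Q s ^ n‖ ≤ K / s ^ n) :
    ∃ S : C0Semigroup H, (∀ t, ‖S.op t‖ ≤ K) ∧ ∀ h k : H,
      Q 1 (h - k) = h ↔
        Tendsto (fun t : ℝ≥0 => ((t : ℝ) : ℂ)⁻¹ • (S.op t h - h)) (𝓝[>] 0) (𝓝 k) := by
  have hK := hQ.nonneg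
  have hE := hQ.norm_exp_smul_yosida_le hd hpow
  choose T hT using hQ.exists_tendsto_exp_smul_yosida hd hpow
  have hTK : ∀ t x, ‖T t x‖ ≤ K * ‖x‖ := fun t x =>
    le_of_tendsto (hT t x).norm
      (Eventually.of_forall fun n => ContinuousLinearMap.le_of_opNorm_le _ (hE n t t.2) x)
  have hcont : ∀ h, Continuous fun t => T t h := by
    intro h
    have hrange : ∀ y ∈ Set.range (Q 1), Continuous fun t => T t y := by
      rintro _ ⟨g, rfl⟩
      -- On the range of `Q 1` the approximating orbits are Lipschitz with constants that converge,
      -- so the limit orbit is Lipschitz.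
      have hb : ∀ s t : ℝ≥0, s ≤ t →
          ‖T t (Q 1 g) - T s (Q 1 g)‖ ≤ K * (K * K * ‖Q 1 g - g‖) * ‖(t : ℝ) - s‖ := by
        intro s t hst
        have hst' : (s : ℝ) ≤ t := by exact_mod_cast hst
        rw [Real.norm_of_nonneg (sub_nonneg.2 hst'), mul_assoc]
        refine le_of_tendsto_of_tendsto' ((hT t _).sub (hT s _)).norm
          ((((hQ.tendsto_yosida hd g).norm.const_mul (K * K)).mul_const
            ((t : ℝ) - s)).const_mul K) fun n => ?_
        exact norm_exp_smul_apply_sub_apply_le (hE n) s.2 hst' _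
      refine (LipschitzWith.of_dist_le_mul
        (K := (K * (K * K * ‖Q 1 g - g‖)).toNNReal) fun t s => ?_).continuous
      rw [Real.coe_toNNReal _ (by positivity), dist_eq_norm, NNReal.dist_eq, ← Real.norm_eq_abs]
      rcases le_total s t with h | h
      · exact hb s t h
      · rw [norm_sub_rev, norm_sub_rev (t : ℝ)]
        exact hb t s h
    rw [continuous_iff_continuousAt]
    intro t
    exact tendsto_apply_of_mem_closure (C := K) (Eventually.of_forall fun s => hTK s)
      (fun y hy => (hrange y hy).tendsto t) (hd h)
  let S : C0Semigroup H :=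
    { op := T
      op_zero := by
        ext h
        refine tendsto_nhds_unique (hT 0 h) ?_
        simp
      op_add := fun s t => by
        ext h
        refine tendsto_nhds_unique (hT (s + t) h) ?_
        have h1 : Tendsto (fun n => NormedSpace.exp ((s : ℝ) • yosida Q n)
            (NormedSpace.exp ((t : ℝ) • yosida Q n) h - T t h)) atTop (𝓝 0) := by
          have h2 := (tendsto_iff_norm_sub_tendsto_zero.1 (hT t h)).const_mul K
          rw [mul_zero] at h2
          exact squeeze_zero_norm
            (fun n => ContinuousLinearMap.le_of_opNorm_le _ (hE n s s.2) _) h2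
        have h3 := h1.add (hT s (T t h))
        rw [zero_add] at h3
        refine h3.congr fun n => ?_
        rw [NNReal.coe_add, add_smul, exp_add_of_commute
          (((Commute.refl (yosida Q n)).smul_left (s : ℝ)).smul_right _)]
        simp
      continuous_op := hcont }
  have hpos : ∀ᶠ t : ℝ≥0 in 𝓝[>] 0, 0 < t := self_mem_nhdsWithin
  have hgen : ∀ g : H, Tendsto (fun t : ℝ≥0 => ((t : ℝ) : ℂ)⁻¹ • (T t (Q 1 g) - Q 1 g))
      (𝓝[>] 0) (𝓝 (Q 1 g - g)) := by
    intro g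
    set k := Q 1 g - g with hk
    rw [Metric.tendsto_nhds]
    intro ε hε
    -- The vector `k` need not lie in the range of `Q 1`, so `yosida Q n k` may be unbounded in `n`;
    -- a nearby `Q 1 g'` replaces it.
    obtain ⟨_, ⟨g', rfl⟩, hkk'⟩ := Metric.mem_closure_iff.1 (hd k) (ε / (2 * (K + 1)))
      (by positivity)
    have hlim : Tendsto (fun t : ℝ≥0 => (K + 1) * ‖k - Q 1 g'‖
        + K * K * ‖Q 1 g' - g'‖ * (t : ℝ)) (𝓝[>] 0) (𝓝 ((K + 1) * ‖k - Q 1 g'‖)) := by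
      have h1 : Continuous fun t : ℝ≥0 => (K + 1) * ‖k - Q 1 g'‖
        + K * K * ‖Q 1 g' - g'‖ * (t : ℝ) := by fun_prop
      simpa using (h1.tendsto 0).mono_left nhdsWithin_le_nhds
    have hlt : (K + 1) * ‖k - Q 1 g'‖ < ε := by
      rw [← dist_eq_norm]
      calc (K + 1) * dist k (Q 1 g') < (K + 1) * (ε / (2 * (K + 1))) := by gcongr
        _ = ε / 2 := by field_simp
        _ < ε := by linarith
    filter_upwards [hlim.eventually (gt_mem_nhds hlt), hpos] with t ht ht0
    have ht0' : (0 : ℝ) < t := by exact_mod_cast ht0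
    have h1 : ‖T t (Q 1 g) - Q 1 g - (t : ℝ) • k‖
        ≤ ((K + 1) * ‖k - Q 1 g'‖ + K * K * ‖Q 1 g' - g'‖ * (t : ℝ)) * t := by
      have h2 := ((((((hQ.tendsto_yosida hd g).sub_const k).norm.const_mul K).add_const
        ((K + 1) * ‖k - Q 1 g'‖)).add (((hQ.tendsto_yosida hd g').norm.const_mul
          (K * K)).mul_const (t : ℝ))).mul_const (t : ℝ))
      rw [hk, sub_self, norm_zero, mul_zero, zero_add, ← hk] at h2
      exact le_of_tendsto_of_tendsto' (((hT t _).sub_const _).sub_const _).norm h2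
        fun n => norm_exp_smul_apply_sub_sub_le (hE n) t.2 _ _ _
    have h3 : ((t : ℝ) : ℂ)⁻¹ • (T t (Q 1 g) - Q 1 g) - k
        = (t : ℝ)⁻¹ • (T t (Q 1 g) - Q 1 g - (t : ℝ) • k) := by
      rw [← Complex.ofReal_inv, Complex.coe_smul, smul_sub _ _ ((t : ℝ) • k), smul_smul,
        inv_mul_cancel₀ ht0'.ne', one_smul]
    rw [dist_eq_norm, h3, norm_smul, Real.norm_of_nonneg (by positivity), inv_mul_lt_iff₀ ht0']
    nlinarith
  have hcomm : ∀ t h, Q 1 (T t h) = T t (Q 1 h) := by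
    intro t h
    refine tendsto_nhds_unique (((Q 1).continuous.tendsto _).comp (hT t h))
      ((hT t (Q 1 h)).congr fun n => ?_)
    have := commute_exp_right ((hQ.commute_yosida one_pos n).smul_right (t : ℝ))
    exact (congrArg (fun L : H →L[ℂ] H => L h) this.eq).symm
  refine ⟨S, fun t => ContinuousLinearMap.opNorm_le_bound _ hK (hTK t), fun h k => ⟨?_, ?_⟩⟩
  · intro hhk
    have h1 := hgen (h - k)
    rw [hhk, sub_sub_cancel] at h1
    exact h1
  · intro hlim
    -- Applying `Q 1` to the difference quotient at `h` gives the one at `Q 1 h`, whose limit is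
    -- already known to be `Q 1 h - h`. Hence `Q 1 k = Q 1 h - h`.
    have h1 : Tendsto (fun t : ℝ≥0 => ((t : ℝ) : ℂ)⁻¹ • (T t (Q 1 h) - Q 1 h))
        (𝓝[>] 0) (𝓝 (Q 1 k)) := by
      refine (((Q 1).continuous.tendsto _).comp hlim).congr fun t => ?_
      rw [← hcomm]
      simp [S]
    have h2 := tendsto_nhds_unique h1 (hgen h)
    rw [map_sub, h2]
    abel

end IsPseudoResolvent

/-! ### Exponential rescaling of semigroups -/

namespace C0Semigroup

variable {H : Type*} [NormedAddCommGroup H] [NormedSpace ℂ H]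

/-- The semigroup `e^{α t} S(t)`. -/
def rescale (S : C0Semigroup H) (α : ℝ) : C0Semigroup H where
  op t := (Real.exp (α * t) : ℂ) • S.op t
  op_zero := by simp [S.op_zero]
  op_add s t := by
    ext h
    simp only [S.op_add, NNReal.coe_add, mul_add, Real.exp_add, Complex.ofReal_mul, smul_apply,
      ContinuousLinearMap.comp_apply, map_smul, smul_smul, mul_comm]
  continuous_op h := by
    have := S.continuous_op h
    simp only [smul_apply]
    fun_prop

theorem tendsto_rescale {S : C0Semigroup H} (α : ℝ) {h k : H}
    (hS : Tendsto (fun t : ℝ≥0 => ((t : ℝ) : ℂ)⁻¹ • (S.op t h - h)) (𝓝[>] 0) (𝓝 k)) :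
    Tendsto (fun t : ℝ≥0 => ((t : ℝ) : ℂ)⁻¹ • ((S.rescale α).op t h - h)) (𝓝[>] 0)
      (𝓝 (k + (α : ℂ) • h)) := by
  have h1 : Tendsto (fun t : ℝ≥0 => (t : ℝ)) (𝓝[>] 0) (𝓝[≠] 0) := by
    refine tendsto_nhdsWithin_iff.2 ⟨?_, ?_⟩
    · exact (NNReal.continuous_coe.tendsto' 0 0 rfl).mono_left nhdsWithin_le_nhds
    · filter_upwards [self_mem_nhdsWithin] with t ht
      exact NNReal.coe_ne_zero.2 (ne_of_gt ht)
  have h2 : HasDerivAt (fun t : ℝ => Real.exp (α * t)) α 0 := by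
    simpa using ((hasDerivAt_id (0 : ℝ)).const_mul α).exp
  have h3 := (hasDerivAt_iff_tendsto_slope.1 h2).comp h1
  have h4 : Tendsto (fun t : ℝ≥0 => Real.exp (α * t)) (𝓝[>] 0) (𝓝 1) := by
    have : Continuous fun t : ℝ≥0 => Real.exp (α * t) := by fun_prop
    exact (this.tendsto' 0 1 (by simp)).mono_left nhdsWithin_le_nhds
  have h5 := (((Complex.continuous_ofReal.tendsto _).comp h4).smul hS).add
    (((Complex.continuous_ofReal.tendsto _).comp h3).smul_const h)
  rw [Complex.ofReal_one, one_smul] at h5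
  refine h5.congr fun t => ?_
  simp only [rescale, Function.comp_apply, slope, smul_apply, sub_zero, mul_zero, Real.exp_zero,
    vsub_eq_sub, smul_eq_mul]
  push_cast
  module

theorem tendsto_rescale_iff {S : C0Semigroup H} (α : ℝ) {h k : H} :
    Tendsto (fun t : ℝ≥0 => ((t : ℝ) : ℂ)⁻¹ • ((S.rescale α).op t h - h)) (𝓝[>] 0) (𝓝 k) ↔
      Tendsto (fun t : ℝ≥0 => ((t : ℝ) : ℂ)⁻¹ • (S.op t h - h)) (𝓝[>] 0)
        (𝓝 (k - (α : ℂ) • h)) := by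
  constructor
  · intro hk
    have h1 := tendsto_rescale (-α) hk
    have h2 : ((S.rescale α).rescale (-α)).op = S.op := by
      ext t : 1
      simp only [rescale, smul_smul]
      rw [← Complex.ofReal_mul, ← Real.exp_add]
      simp
    rw [h2] at h1
    simpa [sub_eq_add_neg] using h1
  · intro hk
    simpa using tendsto_rescale α hk

end C0Semigroup

namespace IsPseudoResolvent

variable {H : Type*} [NormedAddCommGroup H] [NormedSpace ℂ H] {Q : ℝ → H →L[ℂ] H} {K : ℝ}

/-- Ensures that `Q 1`, restricted to the closure of its range, again has dense range: `Q(1)w` is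
the limit of `s Q(s)Q(1)w = Q(1)(s Q(s)w)`, and `Q(s)w` lies in the range of `Q 1`. -/
theorem mem_closure_image_closure (hQ : IsPseudoResolvent Q K) {x : H}
    (hx : x ∈ closure (Set.range (Q 1))) :
    x ∈ closure (Q 1 '' closure (Set.range (Q 1))) := by
  refine closure_minimal ?_ isClosed_closure hx
  rintro _ ⟨w, rfl⟩
  refine mem_closure_of_tendsto
    (hQ.tendsto_smul_apply (subset_closure (Set.mem_range_self w))) ?_
  filter_upwards [eventually_gt_atTop 0] with s hs
  have h1 := hQ.identity_apply one_pos hs w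
  refine ⟨(s : ℂ) • Q 1 (w - ((s - 1 : ℝ) : ℂ) • Q s w),
    subset_closure ⟨_, map_smul _ _ _⟩, ?_⟩
  rw [map_sub, map_smul (Q 1) _ (Q s w), ← h1, sub_sub_cancel, map_smul, smul_apply]
  exact congrArg (fun L : H →L[ℂ] H => (s : ℂ) • L w) (hQ.commute one_pos hs).eq

end IsPseudoResolvent

/-! ### Resolvent identities of the pencil -/

section Pencil

variable {X Z : Type*} [NormedAddCommGroup X] [NormedSpace ℂ X]
  [NormedAddCommGroup Z] [NormedSpace ℂ Z] {E : X →L[ℂ] Z} {A : X →ₗ.[ℂ] Z}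
  {s μ : ℂ} {T U : Z →L[ℂ] X}

theorem IsPencilInverse.mem_graph (hT : IsPencilInverse E A s T) (z : Z) :
    (T z, s • E (T z) - z) ∈ A.graph := by
  obtain ⟨h, hz⟩ := hT.1 z
  refine (LinearPMap.mem_graph_iff A).2 ⟨⟨T z, h⟩, rfl, ?_⟩
  rw [eq_sub_iff_add_eq, ← eq_sub_iff_add_eq', hz]

theorem IsPencilInverse.apply_of_mem_graph (hT : IsPencilInverse E A s T) {x : X} {y : Z}
    (h : (x, y) ∈ A.graph) : T (s • E x - y) = x := by
  obtain ⟨x', hx, hy⟩ := (LinearPMap.mem_graph_iff A).1 h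
  rw [← show (x' : X) = x from hx, ← show A x' = y from hy]
  exact hT.2 x'

theorem IsPencilInverse.injective (hT : IsPencilInverse E A s T) : Function.Injective T := by
  rw [injective_iff_map_eq_zero]
  intro z hz
  obtain ⟨h, h'⟩ := hT.1 z
  have h0 : (⟨T z, h⟩ : A.domain) = 0 := Subtype.ext hz
  rw [h0, hz] at h'
  simpa using h'.symm

theorem IsPencilInverse.sub_apply (hT : IsPencilInverse E A s T) (hU : IsPencilInverse E A μ U)
    (z : Z) : T z - U z = (μ - s) • T (E (U z)) := by
  have h := hT.apply_of_mem_graph (hU.mem_graph z)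
  simp only [map_sub, map_smul] at h
  linear_combination (norm := module) h

theorem IsPencilInverse.range_right_subset (hT : IsPencilInverse E A s T)
    (hU : IsPencilInverse E A μ U) : Set.range (T.comp E) ⊆ Set.range (U.comp E) := by
  rintro _ ⟨x, rfl⟩
  refine ⟨x - (s - μ) • T (E x), ?_⟩
  have h := hU.sub_apply hT (E x)
  simp only [ContinuousLinearMap.comp_apply, map_sub, map_smul]
  rw [← h]
  abel

theorem IsPencilInverse.range_left_subset (hT : IsPencilInverse E A s T)
    (hU : IsPencilInverse E A μ U) : Set.range (E.comp T) ⊆ Set.range (E.comp U) := by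
  rintro _ ⟨z, rfl⟩
  refine ⟨z - (s - μ) • E (T z), ?_⟩
  have h := congrArg E (hU.sub_apply hT z)
  simp only [map_sub, map_smul] at h
  simp only [ContinuousLinearMap.comp_apply, map_sub, map_smul]
  rw [← h]
  abel

/-- By the resolvent identity all right resolvents have the same range. An arbitrary `μ` can thus be
traded for the point `α + 1`, where the radial estimates apply. -/
theorem IsPencilInverse.coe_X1 (hT : IsPencilInverse E A s T) (hμ : μ ∈ resolventSet E A) :
    (X1 E A μ : Set X) = closure (Set.range (T.comp E)) := by
  have hμ' := isPencilInverse_pencilInv hμ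
  exact congrArg closure
    ((hμ'.range_right_subset hT).antisymm (hT.range_right_subset hμ'))

theorem IsPencilInverse.coe_Z1 (hT : IsPencilInverse E A s T) (hμ : μ ∈ resolventSet E A) :
    (Z1 E A μ : Set Z) = closure (Set.range (E.comp T)) := by
  have hμ' := isPencilInverse_pencilInv hμ
  exact congrArg closure
    ((hμ'.range_left_subset hT).antisymm (hT.range_left_subset hμ'))

theorem IsPencilInverse.map_Z1_mem_X1 (hT : IsPencilInverse E A s T)
    (hμ : μ ∈ resolventSet E A) {z : Z} (hz : z ∈ Z1 E A μ) : T z ∈ X1 E A μ := by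
  rw [← SetLike.mem_coe, hT.coe_X1 hμ]
  rw [← SetLike.mem_coe, hT.coe_Z1 hμ] at hz
  refine map_mem_closure T.continuous hz ?_
  rintro _ ⟨w, rfl⟩
  exact ⟨T w, rfl⟩

theorem IsPencilInverse.shift {α : ℝ} (hT : IsPencilInverse E (shift E A α) s T) :
    IsPencilInverse E A (s + α) T := by
  refine ⟨fun z => ?_, fun x => ?_⟩
  · obtain ⟨h, hz⟩ := hT.1 z
    refine ⟨h, ?_⟩
    change s • E (T z) - (A ⟨T z, h⟩ - (α : ℂ) • E (T z)) = z at hz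
    rw [add_smul]
    linear_combination (norm := module) hz
  · have hx := hT.2 x
    change T (s • E x - (A x - (α : ℂ) • E x)) = x at hx
    rw [← hx]
    congr 1
    rw [hx]
    module

namespace IsRadialWith

variable {K : ℝ}

theorem isPencilInverse (hA : IsRadialWith E A K) {s : ℝ} (hs : 0 < s) :
    IsPencilInverse E A s (pencilInv E A s) :=
  isPencilInverse_pencilInv (hA.2 s hs).1

theorem isPseudoResolvent_right (hA : IsRadialWith E A K) :
    IsPseudoResolvent (fun s : ℝ => rightResolvent E A s) K where
  identity s t hs ht := by
    ext x
    simpa [rightResolvent] using (hA.isPencilInverse hs).sub_apply (hA.isPencilInverse ht) (E x)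
  bound s hs := by simpa using ((hA.2 s hs).2 1 le_rfl).1

theorem isPseudoResolvent_left (hA : IsRadialWith E A K) :
    IsPseudoResolvent (fun s : ℝ => leftResolvent E A s) K where
  identity s t hs ht := by
    ext z
    simpa [leftResolvent] using
      congrArg E ((hA.isPencilInverse hs).sub_apply (hA.isPencilInverse ht) z)
  bound s hs := by simpa using ((hA.2 s hs).2 1 le_rfl).2

variable {α : ℝ}

theorem coe_X1 (hA : IsRadialWith E (shift E A α) K) (hμ : μ ∈ resolventSet E A) :
    (X1 E A μ : Set X) = closure (Set.range (rightResolvent E (shift E A α) (1 : ℝ))) :=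
  (hA.isPencilInverse one_pos).shift.coe_X1 hμ

theorem coe_Z1 (hA : IsRadialWith E (shift E A α) K) (hμ : μ ∈ resolventSet E A) :
    (Z1 E A μ : Set Z) = closure (Set.range (leftResolvent E (shift E A α) (1 : ℝ))) :=
  (hA.isPencilInverse one_pos).shift.coe_Z1 hμ

theorem eq_zero_of_mem_X1 (hA : IsRadialWith E (shift E A α) K) (hμ : μ ∈ resolventSet E A)
    {x : X} (hx : x ∈ X1 E A μ) (h0 : E x = 0) : x = 0 := by
  rw [← SetLike.mem_coe, hA.coe_X1 hμ] at hx
  exact hA.isPseudoResolvent_right.eq_zero_of_mem_closure hx (by simp [rightResolvent, h0])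

end IsRadialWith

theorem mem_graph_A1E1inv {e : X1 E A μ ≃L[ℂ] Z1 E A μ}
    {hA₁ : ∀ x : (A1 E A μ).domain, A1 E A μ x ∈ Z1 E A μ} {h k : Z1 E A μ} :
    (h, k) ∈ (A1E1inv E A μ e hA₁).graph ↔ ((e.symm h : X), (k : Z)) ∈ A.graph := by
  simp only [LinearPMap.mem_graph_iff]
  constructor
  · rintro ⟨y, hy, hk⟩
    obtain rfl : (y : Z1 E A μ) = h := hy
    obtain rfl : A1E1inv E A μ e hA₁ y = k := hk
    exact ⟨⟨_, y.2⟩, rfl, rfl⟩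
  · rintro ⟨x, hx, hk⟩
    have hd : h ∈ (A1E1inv E A μ e hA₁).domain := by
      change (e.symm h : X) ∈ A.domain
      exact (show (x : X) = e.symm h from hx) ▸ x.2
    refine ⟨⟨h, hd⟩, rfl, Subtype.ext ?_⟩
    rw [← show A x = k from hk]
    exact congrArg A (Subtype.ext (show (x : X) = e.symm h from hx).symm)

end Pencil

/-! ### Splitting of the pencil and the reduced generator -/

section Hilbert

variable {X Z : Type*} [NormedAddCommGroup X] [InnerProductSpace ℂ X]
  [NormedAddCommGroup Z] [InnerProductSpace ℂ Z]
  {E : X →L[ℂ] Z} {A : X →ₗ.[ℂ] Z} {μ : ℂ} {K α : ℝ}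

namespace IsRadialWith

/-- Every `x ∈ D(A)` can be moved into `D(A) ∩ X¹` along `ker E`. -/
theorem exists_mem_graph [CompleteSpace Z] (hA : IsRadialWith E (shift E A α) K) (hμ : μ ∈ resolventSet E A)
    {x : X} {y : Z} (h : (x, y) ∈ A.graph) :
    ∃ x' y', (x', y') ∈ A.graph ∧ E x' = E x ∧ y' ∈ Z1 E A μ := by
  obtain ⟨y', hy', hyy'⟩ := hA.isPseudoResolvent_left.exists_mem_closure y
  set T := pencilInv E (shift E A α) (1 : ℝ) with hTdef
  have hT := (hA.isPencilInverse one_pos).shift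
  rw [← hTdef] at hT
  change E (T (y - y')) = 0 at hyy'
  -- As `E T(y - y') = 0`, the operator `A` sends `T(y - y')` to `-(y - y')`; adding this vector to
  -- `x` changes `A x` from `y` to `y'`.
  have h1 := hT.mem_graph (y - y')
  rw [hyy', smul_zero, zero_sub] at h1
  have h2 := A.graph.add_mem h h1
  refine ⟨x + T (y - y'), y', ?_, by rw [map_add, hyy', add_zero], ?_⟩
  · simpa using h2
  · rwa [← SetLike.mem_coe, hA.coe_Z1 hμ]

variable [CompleteSpace X]

theorem exists_mem_X1 (hA : IsRadialWith E (shift E A α) K) (hμ : μ ∈ resolventSet E A) (x : X) :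
    ∃ y ∈ X1 E A μ, E y = E x := by
  obtain ⟨y, hy, hxy⟩ := hA.isPseudoResolvent_right.exists_mem_closure x
  refine ⟨y, ?_, ?_⟩
  · rwa [← SetLike.mem_coe, hA.coe_X1 hμ]
  · have := (hA.isPencilInverse one_pos).injective (hxy.trans (map_zero _).symm)
    rw [map_sub, sub_eq_zero] at this
    exact this.symm

/-- One inclusion is closedness of `ran E`; the other is `E(X¹) = ran E`, from `X = X¹ + ker E`. -/
theorem coe_Z1_eq_range (hA : IsRadialWith E (shift E A α) K) (hE : IsClosed (Set.range E))
    (hμ : μ ∈ resolventSet E A) : (Z1 E A μ : Set Z) = Set.range E := by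
  refine Set.Subset.antisymm (closure_minimal ?_ hE) ?_
  · rintro _ ⟨z, rfl⟩
    exact ⟨_, rfl⟩
  · rintro _ ⟨x, rfl⟩
    obtain ⟨y, hy, hxy⟩ := hA.exists_mem_X1 hμ x
    exact hxy ▸ map_mem_Z1 E A μ ⟨y, hy⟩

theorem map_mem_Z1 (hA : IsRadialWith E (shift E A α) K) (hE : IsClosed (Set.range E))
    (hμ : μ ∈ resolventSet E A) (x : X) : E x ∈ Z1 E A μ := by
  rw [← SetLike.mem_coe, hA.coe_Z1_eq_range hE hμ]
  exact Set.mem_range_self x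

/-- Here `x = (μE - A)⁻¹(μEx - y)`, and `(μE - A)⁻¹` maps `Z¹` into `X¹`. -/
theorem mem_X1_of_mem_graph (hA : IsRadialWith E (shift E A α) K) (hE : IsClosed (Set.range E))
    (hμ : μ ∈ resolventSet E A) {x : X} {y : Z} (h : (x, y) ∈ A.graph) (hy : y ∈ Z1 E A μ) :
    x ∈ X1 E A μ := by
  have hT := isPencilInverse_pencilInv hμ
  rw [← hT.apply_of_mem_graph h]
  exact hT.map_Z1_mem_X1 hμ
    (Submodule.sub_mem _ (Submodule.smul_mem _ _ (hA.map_mem_Z1 hE hμ x)) hy)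

variable [CompleteSpace Z]

/-- The corrected vector `x'` also lies in `X¹` and differs from `x` by an element of `ker E`, so
`x' = x`. -/
theorem mem_Z1_of_mem_graph (hA : IsRadialWith E (shift E A α) K) (hE : IsClosed (Set.range E))
    (hμ : μ ∈ resolventSet E A) {x : X} {y : Z} (h : (x, y) ∈ A.graph) (hx : x ∈ X1 E A μ) :
    y ∈ Z1 E A μ := by
  obtain ⟨x', y', h', hE', hy'⟩ := hA.exists_mem_graph hμ h
  have hx' := hA.mem_X1_of_mem_graph hE hμ h' hy'
  have h0 : x - x' = 0 := hA.eq_zero_of_mem_X1 hμ (Submodule.sub_mem _ hx hx') (by simp [hE'])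
  rw [sub_eq_zero] at h0
  subst h0
  have := A.graph.sub_mem h h'
  have h1 := LinearPMap.graph_fst_eq_zero_snd A this (sub_self x)
  exact (sub_eq_zero.1 h1 : y = y') ▸ hy'

theorem exists_equiv (hA : IsRadialWith E (shift E A α) K) (hE : IsClosed (Set.range E))
    (hμ : μ ∈ resolventSet E A) :
    ∃ e : X1 E A μ ≃L[ℂ] Z1 E A μ, (e : X1 E A μ →L[ℂ] Z1 E A μ) = E1 E A μ := by
  have : CompleteSpace (X1 E A μ) := (Submodule.isClosed_topologicalClosure _).completeSpace_coe
  have : CompleteSpace (Z1 E A μ) := (Submodule.isClosed_topologicalClosure _).completeSpace_coe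
  refine ⟨ContinuousLinearEquiv.ofBijective (E1 E A μ) ?_ ?_,
    ContinuousLinearEquiv.coe_ofBijective _ _ _⟩
  · refine LinearMap.ker_eq_bot'.2 fun x hx => Subtype.ext ?_
    exact hA.eq_zero_of_mem_X1 hμ x.2 (congrArg Subtype.val hx)
  · refine LinearMap.range_eq_top.2 fun z => ?_
    have hz : (z : Z) ∈ Set.range E := by
      rw [← hA.coe_Z1_eq_range hE hμ]
      exact z.2
    obtain ⟨x, hx⟩ := hz
    obtain ⟨y, hy, hxy⟩ := hA.exists_mem_X1 hμ x
    exact ⟨⟨y, hy⟩, Subtype.ext (hxy.trans hx)⟩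

end IsRadialWith

theorem IsRadialWith.exists_c0Semigroup [CompleteSpace Z]
    (hA : IsRadialWith E (shift E A α) K)
    (hμ : μ ∈ resolventSet E A) {e : X1 E A μ ≃L[ℂ] Z1 E A μ}
    (he : (e : X1 E A μ →L[ℂ] Z1 E A μ) = E1 E A μ)
    (hA₁ : ∀ x : (A1 E A μ).domain, A1 E A μ x ∈ Z1 E A μ) :
    ∃ S : C0Semigroup (Z1 E A μ), S.IsGeneratedBy (A1E1inv E A μ e hA₁) ∧
      ∀ t : ℝ≥0, ‖S.op t‖ ≤ K * Real.exp (α * t) := by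
  have : CompleteSpace (Z1 E A μ) := (Submodule.isClosed_topologicalClosure _).completeSpace_coe
  have heE : ∀ x : X1 E A μ, (e x : Z) = E x := fun x =>
    congrArg (fun L : X1 E A μ →L[ℂ] Z1 E A μ => (L x : Z)) he
  have hT : ∀ s : ℝ, 0 < s → IsPencilInverse E A (s + α) (pencilInv E (shift E A α) s) :=
    fun s hs => (hA.isPencilInverse hs).shift
  have hmap : ∀ s : ℝ, ∀ z : Z1 E A μ, leftResolvent E (shift E A α) s z ∈ Z1 E A μ := by
    intro s z
    -- `Q` below is defined for every real `s`; off the resolvent set `pencilInv` is `0` by default.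
    by_cases hs : (s : ℂ) ∈ resolventSet E (shift E A α)
    · exact OperatorPencil.map_mem_Z1 E A μ
        ⟨_, (isPencilInverse_pencilInv hs).shift.map_Z1_mem_X1 hμ z.2⟩
    · simp [leftResolvent, pencilInv, hs]
  set Q : ℝ → Z1 E A μ →L[ℂ] Z1 E A μ := fun s =>
    ((leftResolvent E (shift E A α) s).comp (Z1 E A μ).subtypeL).codRestrict (Z1 E A μ) (hmap s)
    with hQdef
  have hQc : ∀ s z, (Q s z : Z) = leftResolvent E (shift E A α) s z := fun _ _ => rfl
  have hQn : ∀ s n z, ((Q s ^ n) z : Z) = (leftResolvent E (shift E A α) s ^ n) z := by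
    intro s n
    induction n with
    | zero => intro z; rfl
    | succ n ih =>
      intro z
      simp only [pow_succ, mul_apply_eq_comp]
      rw [ih, hQc]
  have hL := hA.isPseudoResolvent_left
  have hpow : ∀ s : ℝ, 0 < s → ∀ n : ℕ, 1 ≤ n → ‖Q s ^ n‖ ≤ K / s ^ n := by
    intro s hs n hn
    refine ContinuousLinearMap.opNorm_le_bound _ (div_nonneg hA.1.le (by positivity)) fun z => ?_
    rw [← Submodule.norm_coe, hQn]
    exact ContinuousLinearMap.le_of_opNorm_le _ ((hA.2 s hs).2 n hn).2 _
  have hQ : IsPseudoResolvent Q K :=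
    { identity := fun s t hs ht => by
        ext z
        exact hL.identity_apply hs ht (z : Z)
      bound := fun s hs => by simpa using hpow s hs 1 le_rfl }
  have hd : DenseRange (Q 1) := by
    intro z
    have hz : (z : Z) ∈ (Z1 E A μ : Set Z) := z.2
    rw [hA.coe_Z1 hμ] at hz
    have h1 := hL.mem_closure_image_closure hz
    rw [← hA.coe_Z1 hμ] at h1
    rw [closure_subtype]
    refine closure_mono ?_ h1
    rintro _ ⟨w, hw, rfl⟩
    exact ⟨Q 1 ⟨w, hw⟩, ⟨_, rfl⟩, rfl⟩
  obtain ⟨S, hSK, hS⟩ := hQ.exists_c0Semigroup hd hpow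
  refine ⟨S.rescale α, fun h k => ?_, fun t => ?_⟩
  · rw [C0Semigroup.tendsto_rescale_iff, ← hS, mem_graph_A1E1inv]
    have hT1 := hT 1 one_pos
    set T := pencilInv E (shift E A α) (1 : ℝ)
    have hQT : ∀ z, (Q 1 z : Z) = E (T z) := fun _ => rfl
    -- The shift by `α` turns the graph condition `Q 1 (h - (k - αh)) = h` into `E T((1 + α)h - k) =
    -- h`, with `T` the pencil inverse at `1 + α`.
    have hz : ((h - (k - (α : ℂ) • h) : Z1 E A μ) : Z)
        = (((1 : ℝ) : ℂ) + α) • (h : Z) - k := by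
      push_cast
      module
    rw [← Subtype.coe_inj, hQT, hz]
    have hEh : E (e.symm h) = h := by rw [← heE, e.apply_symm_apply]
    constructor
    · intro hk
      have h1 := hT1.apply_of_mem_graph hk
      rw [hEh] at h1
      rw [h1, hEh]
    · intro hk
      have h1 := hT1.mem_graph ((((1 : ℝ) : ℂ) + α) • (h : Z) - k)
      rw [hk, sub_sub_cancel] at h1
      have h2 : T ((((1 : ℝ) : ℂ) + α) • (h : Z) - k) ∈ X1 E A μ :=
        hT1.map_Z1_mem_X1 hμ (Submodule.sub_mem _ (Submodule.smul_mem _ _ h.2) k.2)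
      have h3 : e.symm h = ⟨_, h2⟩ := by
        rw [ContinuousLinearEquiv.symm_apply_eq]
        exact Subtype.ext ((heE ⟨_, h2⟩).trans hk).symm
      rwa [h3]
  · simp only [C0Semigroup.rescale, norm_smul, Complex.norm_real,
      Real.norm_of_nonneg (Real.exp_pos _).le]
    rw [mul_comm]
    exact mul_le_mul_of_nonneg_right (hSK t) (Real.exp_pos _).le

end Hilbert

/-! ### Transport of classical solutions and well-posedness -/

section Derivatives

variable {Z : Type*} [NormedAddCommGroup Z] [NormedSpace ℂ Z] {V : Submodule ℂ Z}

theorem hasDerivWithinAt_submodule_iff {f : ℝ → V} {f' : V} {s : Set ℝ} {t : ℝ} :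
    HasDerivWithinAt f f' s t ↔ HasDerivWithinAt (fun u => (f u : Z)) f' s t := by
  rw [hasDerivWithinAt_iff_tendsto_slope, hasDerivWithinAt_iff_tendsto_slope,
    Topology.IsInducing.subtypeVal.tendsto_nhds_iff]
  rfl

/-- The derivative is a limit of right difference quotients, which lie in the closed subspace. -/
theorem mem_of_hasDerivWithinAt_Ici (hV : IsClosed (V : Set Z)) {f : ℝ → Z} {f' : Z} {t : ℝ}
    (ht : 0 ≤ t) (hf : ∀ s, f s ∈ V) (h : HasDerivWithinAt f f' (Set.Ici 0) t) : f' ∈ V := by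
  have h1 : HasDerivWithinAt f f' (Set.Ioi t) t :=
    h.mono fun s hs => ht.trans (le_of_lt hs)
  rw [hasDerivWithinAt_iff_tendsto_slope' Set.self_notMem_Ioi] at h1
  refine hV.mem_of_tendsto h1 (Eventually.of_forall fun s => ?_)
  exact (V.restrictScalars ℝ).smul_mem _ (V.sub_mem (hf s) (hf t))

end Derivatives

section Solutions

variable {X Z : Type*} [NormedAddCommGroup X] [InnerProductSpace ℂ X] [CompleteSpace X]
  [NormedAddCommGroup Z] [InnerProductSpace ℂ Z]
  {E : X →L[ℂ] Z} {A : X →ₗ.[ℂ] Z} {μ : ℂ} {K α : ℝ}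

/-- Classical solutions of the pencil equation are the lifts of those of the reduced equation. -/
theorem IsRadialWith.isClassicalSolution_iff (hA : IsRadialWith E (shift E A α) K)
    (hE : IsClosed (Set.range E)) (hμ : μ ∈ resolventSet E A)
    {e : X1 E A μ ≃L[ℂ] Z1 E A μ} (he : (e : X1 E A μ →L[ℂ] Z1 E A μ) = E1 E A μ)
    (hA₁ : ∀ x : (A1 E A μ).domain, A1 E A μ x ∈ Z1 E A μ) (z₀ : Z) (x : ℝ≥0 → X) :
    IsClassicalSolution E A z₀ x ↔
      ∃ (w₀ : Z1 E A μ) (z₁ : ℝ≥0 → Z1 E A μ), (w₀ : Z) = z₀ ∧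
        IsClassicalSolution (ContinuousLinearMap.id ℂ (Z1 E A μ)) (A1E1inv E A μ e hA₁) w₀ z₁ ∧
        ∀ t, x t = (e.symm (z₁ t) : X) := by
  have heE : ∀ x : X1 E A μ, (e x : Z) = E x := fun x =>
    congrArg (fun L : X1 E A μ →L[ℂ] Z1 E A μ => (L x : Z)) he
  constructor
  · rintro ⟨h0, y, hyc, hxy, hder⟩
    have hy : ∀ t, y t ∈ Z1 E A μ := fun t =>
      mem_of_hasDerivWithinAt_Ici (Submodule.isClosed_topologicalClosure _) t.2
        (fun s => hA.map_mem_Z1 hE hμ _) (hder t)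
    have hx : ∀ t, x t ∈ X1 E A μ := fun t => hA.mem_X1_of_mem_graph hE hμ (hxy t) (hy t)
    refine ⟨e ⟨x 0, hx 0⟩, fun t => e ⟨x t, hx t⟩, (heE _).trans h0,
      ⟨rfl, fun t => ⟨y t, hy t⟩, hyc.subtype_mk _, fun t => ?_, fun t => ?_⟩, fun t => ?_⟩
    · rw [mem_graph_A1E1inv, e.symm_apply_apply]
      exact hxy t
    · rw [hasDerivWithinAt_submodule_iff]
      simpa only [ContinuousLinearMap.id_apply, heE] using hder t
    · rw [e.symm_apply_apply]
  · rintro ⟨w₀, z₁, rfl, ⟨h0, y, hyc, hzy, hder⟩, hx⟩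
    have hEx : ∀ t, E (x t) = z₁ t := fun t => by rw [hx, ← heE, e.apply_symm_apply]
    refine ⟨?_, fun t => y t, continuous_subtype_val.comp hyc, fun t => ?_, fun t => ?_⟩
    · rw [hEx]
      exact congrArg Subtype.val h0
    · rw [hx]
      exact mem_graph_A1E1inv.1 (hzy t)
    · simp only [hEx]
      exact hasDerivWithinAt_submodule_iff.1 (hder t)

theorem IsRadialWith.isWellPosed_iff [CompleteSpace Z] (hA : IsRadialWith E (shift E A α) K)
    (hE : IsClosed (Set.range E)) (hμ : μ ∈ resolventSet E A)
    {e : X1 E A μ ≃L[ℂ] Z1 E A μ} (he : (e : X1 E A μ →L[ℂ] Z1 E A μ) = E1 E A μ)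
    (hA₁ : ∀ x : (A1 E A μ).domain, A1 E A μ x ∈ Z1 E A μ) :
    IsWellPosed E A ↔
      IsWellPosed (ContinuousLinearMap.id ℂ (Z1 E A μ)) (A1E1inv E A μ e hA₁) := by
  have heE : ∀ x : X1 E A μ, (e x : Z) = E x := fun x =>
    congrArg (fun L : X1 E A μ →L[ℂ] Z1 E A μ => (L x : Z)) he
  have hsol := hA.isClassicalSolution_iff hE hμ he hA₁
  have hlift : ∀ {w₀ z₁}, IsClassicalSolution (ContinuousLinearMap.id ℂ (Z1 E A μ))
      (A1E1inv E A μ e hA₁) w₀ z₁ →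
      IsClassicalSolution E A (w₀ : Z) fun t => (e.symm (z₁ t) : X) :=
    fun {w₀ z₁} h => (hsol _ _).2 ⟨w₀, z₁, rfl, h, fun _ => rfl⟩
  constructor
  · rintro ⟨hex, hbd⟩
    refine ⟨?_, fun T => ?_⟩
    · rintro _ ⟨w₀, hw₀, rfl⟩
      obtain ⟨x, hx, hxu⟩ := hex w₀ ⟨_, hw₀, by
        change E (e.symm w₀) = w₀
        rw [← heE, e.apply_symm_apply]⟩
      obtain ⟨w₁, z₁, hw, hz₁, -⟩ := (hsol _ _).1 hx
      obtain rfl := Subtype.ext hw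
      refine ⟨z₁, hz₁, fun z₂ hz₂ => funext fun t => ?_⟩
      have h := (hxu _ (hlift hz₂)).trans (hxu _ (hlift hz₁)).symm
      exact e.symm.injective (Subtype.ext (congrFun h t))
    · obtain ⟨C, hC⟩ := hbd T
      refine ⟨‖E‖ * C, fun w₀ z₁ hz₁ t ht => ?_⟩
      have h := hC _ _ (hlift hz₁) t ht
      have hz : (z₁ t : Z) = E (e.symm (z₁ t)) := by rw [← heE, e.apply_symm_apply]
      rw [← Submodule.norm_coe, hz, mul_assoc]
      exact E.le_opNorm_of_le h
  · rintro ⟨hex, hbd⟩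
    refine ⟨?_, fun T => ?_⟩
    · rintro _ ⟨x₀, hx₀, rfl⟩
      -- Correcting along `ker E` leaves the initial value `E x₀` unchanged and places it in the
      -- domain of the reduced operator.
      obtain ⟨x, y, hxy, hx, hy⟩ :=
        hA.exists_mem_graph hμ (A.mem_graph (⟨x₀, hx₀⟩ : A.domain))
      have hx1 := hA.mem_X1_of_mem_graph hE hμ hxy hy
      set w₀ : Z1 E A μ := e ⟨x, hx1⟩ with hw₀
      have hw₀E : (w₀ : Z) = E x₀ := (heE _).trans hx
      have hmem : (w₀, (⟨y, hy⟩ : Z1 E A μ)) ∈ (A1E1inv E A μ e hA₁).graph := by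
        rw [mem_graph_A1E1inv, hw₀, e.symm_apply_apply]
        exact hxy
      obtain ⟨z₁, hz₁, hz₁u⟩ := hex w₀ ⟨w₀, LinearPMap.mem_domain_of_mem_graph hmem, rfl⟩
      refine ⟨_, hw₀E ▸ hlift hz₁, fun x' hx' => ?_⟩
      obtain ⟨w₁, z₂, hw, hz₂, hx'z⟩ := (hsol _ _).1 hx'
      obtain rfl : w₁ = w₀ := Subtype.ext (hw.trans hw₀E.symm)
      obtain rfl := hz₁u z₂ hz₂
      exact funext hx'z
    · obtain ⟨C, hC⟩ := hbd T
      refine ⟨‖(e.symm : Z1 E A μ →L[ℂ] X1 E A μ)‖ * C, fun z₀ x hx t ht => ?_⟩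
      obtain ⟨w₀, z₁, rfl, hz₁, hxz⟩ := (hsol _ _).1 hx
      rw [hxz, mul_assoc]
      exact (e.symm : Z1 E A μ →L[ℂ] X1 E A μ).le_opNorm_of_le (hC w₀ z₁ hz₁ t ht)

end Solutions

end OperatorPencil

end

theorem mainTheorem4 {X Z : Type*}
    [NormedAddCommGroup X] [InnerProductSpace ℂ X] [CompleteSpace X]
    [NormedAddCommGroup Z] [InnerProductSpace ℂ Z] [CompleteSpace Z]
    (E : X →L[ℂ] Z) (A : X →ₗ.[ℂ] Z)
    (hA_dense : Dense (A.domain : Set X)) (hA_closed : A.IsClosed)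
    (α K : ℝ) (hrad : OperatorPencil.IsRadialWith E (OperatorPencil.shift E A α) K)
    (hran : IsClosed (Set.range E)) :
    (∀ s : ℝ, α < s → (s : ℂ) ∈ OperatorPencil.resolventSet E A) ∧
    ∀ μ ∈ OperatorPencil.resolventSet E A,
      -- `E₁ : X¹ → Z¹` is boundedly invertible and `A₁` maps into `Z¹`
      ∃ (e : OperatorPencil.X1 E A μ ≃L[ℂ] OperatorPencil.Z1 E A μ)
        (_ : (e : OperatorPencil.X1 E A μ →L[ℂ] OperatorPencil.Z1 E A μ) =
          OperatorPencil.E1 E A μ)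
        (hA : ∀ x : (OperatorPencil.A1 E A μ).domain,
          OperatorPencil.A1 E A μ x ∈ OperatorPencil.Z1 E A μ),
        -- the domain of `A₁ E₁⁻¹` is `E₁(D(A) ∩ X¹)`
        (OperatorPencil.A1E1inv E A μ e hA).domain =
          (A.domain.comap (OperatorPencil.X1 E A μ).subtype).map
            (OperatorPencil.E1 E A μ :
              OperatorPencil.X1 E A μ →ₗ[ℂ] OperatorPencil.Z1 E A μ) ∧
        -- `A₁ E₁⁻¹` generates a `C₀`-semigroup on `Z¹` with bound `K e^{α t}`
        (∃ S : OperatorPencil.C0Semigroup (OperatorPencil.Z1 E A μ),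
          S.IsGeneratedBy (OperatorPencil.A1E1inv E A μ e hA) ∧
          ∀ t : NNReal, ‖S.op t‖ ≤ K * Real.exp (α * t)) ∧
        -- the solutions `x` of the DAE are the functions `E₁⁻¹ z₁` with `ż₁ = A₁ E₁⁻¹ z₁`
        (∀ (z₀ : Z) (x : NNReal → X),
          OperatorPencil.IsClassicalSolution E A z₀ x ↔
            ∃ (w₀ : OperatorPencil.Z1 E A μ) (z₁ : NNReal → OperatorPencil.Z1 E A μ),
              (w₀ : Z) = z₀ ∧
              OperatorPencil.IsClassicalSolution
                (ContinuousLinearMap.id ℂ (OperatorPencil.Z1 E A μ))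
                (OperatorPencil.A1E1inv E A μ e hA) w₀ z₁ ∧
              ∀ t, x t = (e.symm (z₁ t) : X)) ∧
        -- well-posedness of the DAE is equivalent to that of the reduced Cauchy problem
        (OperatorPencil.IsWellPosed E A ↔
          OperatorPencil.IsWellPosed
            (ContinuousLinearMap.id ℂ (OperatorPencil.Z1 E A μ))
            (OperatorPencil.A1E1inv E A μ e hA)) := by
  refine ⟨fun s hs => ?_, fun μ hμ => ?_⟩
  · have h := (hrad.isPencilInverse (sub_pos.2 hs)).shift
    rw [Complex.ofReal_sub, sub_add_cancel] at h
    exact ⟨_, h⟩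
  obtain ⟨e, he⟩ := hrad.exists_equiv hran hμ
  have hA : ∀ x : (OperatorPencil.A1 E A μ).domain,
      OperatorPencil.A1 E A μ x ∈ OperatorPencil.Z1 E A μ := fun x =>
    hrad.mem_Z1_of_mem_graph hran hμ (A.mem_graph (⟨_, x.2⟩ : A.domain))
      (x : OperatorPencil.X1 E A μ).2
  refine ⟨e, he, hA, ?_, hrad.exists_c0Semigroup hμ he hA,
    hrad.isClassicalSolution_iff hran hμ he hA, hrad.isWellPosed_iff hran hμ he hA⟩
  rw [← he]
  ext z
  constructor
  · intro hz
    exact ⟨e.symm z, hz, e.apply_symm_apply z⟩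
  · rintro ⟨x, hx, rfl⟩
    change ((e.symm (e x) : OperatorPencil.X1 E A μ) : X) ∈ A.domain
    rw [e.symm_apply_apply]
    exact hx
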